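/- Let $(R,\mathfrak m)$ be a one-dimensional Noetherian local domain with infinite residue field $k$ and quotient field $K$, whose integral closure $\overline R$ in $K$ is a finite $R$-module and a discrete valuation ring (with valuation $v$ of $K$, normalized to have value $1$ on a uniformizer), and suppose that the natural map from $k$ to the residue field of $\overline R$ is an isomorphism. Let $I$ be a non-principal $\mathfrak m$-primary ideal of $R$. Write $\ell$ for the length of $R$-modules, $A:B=\{x\in K\mid xB\subseteq A\}$ for $R$-submodules $A,B$ of $K$, $A^{*}=R:A$, and $v(A)=\{v(x)\mid x\in A,\ x\ne 0\}$. *Invariants of $I$.* Let $h_I(z)\in\mathbb Z[z]$ be the polynomial with $\sum_{n\ge 0}\ell(I^n/I^{n+1})z^n=h_I(z)/(1-z)$; put $e=h_I(1)$ (the multiplicity of $I$) and $\rho=h_I'(1)$ (the genus of $I$). A minimal reduction of $I$ is an element $x\in I$ with $I^{n+1}=xI^n$ for all sufficiently large $n$; for such an $x$ let $\nu$, the reduction exponent, be the least integer with $I^{n+1}=xI^n$ for all $n\ge\nu$. Let $\Lambda=\bigcup_{n\ge 0}(I^n:I^n)$ be the blowing-up of $R$ along $I$. *Type sequence of $R$.*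 Let $\gamma=R:\overline R$, $n=\ell(R/\gamma)$, and let $0=s_0<s_1<\dots<s_n$ be the first $n+1$ elements of $v(R)$. Put $R_i=\{x\in R\mid v(x)\ge s_i\}$ for $0\le i\le n$ and $r_i=\ell\big((R:R_i)/(R:R_{i-1})\big)$ for $1\le i\le n$. Finally let $$\Gamma=\{i\in\{1,\dots,n\}\mid s_{i-1}\in v(R:\Lambda)\},\qquad d(R:\Lambda)=\ell(\overline R/\Lambda^{**})-\sum_{i\in\Gamma}r_i ,$$ and let $\sum_{i\notin\Gamma}$ denote the sum over $i\in\{1,\dots,n\}\setminus\Gamma$. Then $I$ has a minimal reduction, and for every minimal reduction of $I$ the following hold. 1. $\displaystyle 2\rho=e\nu+\sum_{i\notin\Gamma}(r_i-1)-d(R:\Lambda)-\ell(\Lambda^{**}/\Lambda)-\ell\big((R:\Lambda)/I^{\nu}\big).$ 2. $\displaystyle 2\rho=e\nu+\sum_{i\notin\Gamma}(r_i-1)$ if and only if $R:\Lambda=I^{\nu}$ and $d(R:\Lambda)=0$. -/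

import Mathlib

open scoped Polynomial PowerSeries

noncomputable section

namespace BlowUp

/-! ### Rings and fractional ideals -/

section Rings

variable (R : Type*) [CommRing R] (K : Type*) [Field K] [Algebra R K]

/-- `R` itself, as an `R`-submodule of its quotient field `K`. -/
abbrev base : Submodule R K := 1

/-- The integral closure of `R` in `K`, as an `R`-submodule of `K`. -/
abbrev intCl : Submodule R K := Subalgebra.toSubmodule (integralClosure R K)

/-- The dual `J* = R : J = {x ∈ K | x J ⊆ R}`; Mathlib's quotient `A / B` of submodules of `K`
is `{x : K | x B ⊆ A}`. -/
def dual {R : Type*} [CommRing R] {K : Type*} [Field K] [Algebra R K] (J : Submodule R K) :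
    Submodule R K := base R K / J

/-- The conductor ideal `R : intCl R K`. -/
def conductor : Submodule R K := dual (intCl R K)

variable {R K}

/-- The length of the `R`-module `A / B` for `B ⊆ A ⊆ K` (used only when it is finite). -/
def len (A B : Submodule R K) : ℕ := (Module.length R (A ⧸ B.submoduleOf A)).toNat

variable (R K) in
/-- Residual rationality: the natural map from `R` to the residue field of its integral closure
is onto, so that it induces an isomorphism of residue fields. -/
def ResiduallyRational [IsLocalRing (integralClosure R K)] : Prop :=
  Function.Surjective
    ((IsLocalRing.residue (integralClosure R K)).comp (algebraMap R (integralClosure R K)))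

end Rings

/-! ### The valuation, the value semigroup and the type sequence -/

section Valuation

variable (R : Type*) [CommRing R] [IsDomain R] (K : Type*) [Field K] [Algebra R K]
  [IsFractionRing R K]

theorem isFractionRing_intCl : IsFractionRing (integralClosure R K) K :=
  integralClosure.isFractionRing_of_finite_extension (A := R) K K

variable [IsDiscreteValuationRing (integralClosure R K)]

/-- The valuation of `K` associated with the discrete valuation ring `integralClosure R K`, in
multiplicative notation: an element of (additive) value `n` has value `WithZero.exp (-n)`. -/
def val : Valuation K (WithZero (Multiplicative ℤ)) :=
  haveI := isFractionRing_intCl R K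
  (IsDiscreteValuationRing.maximalIdeal (integralClosure R K)).valuation K

variable {R K}

/-- The value set `v(J) = {v(x) | x ∈ J, x ≠ 0} ⊆ ℤ`. -/
def valueSet (J : Submodule R K) : Set ℤ :=
  {n | ∃ x ∈ J, val R K x = WithZero.exp (-n)}

variable (R K)

/-- `n = ℓ(R / conductor) = c - δ`. -/
def typeLength : ℕ := len (base R K) (conductor R K)

/-- `semi R K i` is `s_i`, the `i`-th element (counted from `i = 0`) of the numerical semigroup `v(R) ⊆ ℕ`. -/
def semi (i : ℕ) : ℕ := Nat.nth (fun m : ℕ => (m : ℤ) ∈ valueSet (base R K)) i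

theorem val_algebraMap_le_one (a : R) : val R K (algebraMap R K a) ≤ 1 := by
  have := isFractionRing_intCl R K
  exact (IsDiscreteValuationRing.maximalIdeal (integralClosure R K)).valuation_le_one
    (K := K) (algebraMap R (integralClosure R K) a)

/-- `R_i = {x ∈ R | v(x) ≥ s_i}`. -/
def filt (i : ℕ) : Submodule R K where
  carrier := {x | x ∈ base R K ∧ val R K x ≤ WithZero.exp (-(semi R K i : ℤ))}
  zero_mem' := ⟨zero_mem _, by simp⟩
  add_mem' := fun ha hb => ⟨add_mem ha.1 hb.1, (val R K).map_add_le ha.2 hb.2⟩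
  smul_mem' := fun a x hx => ⟨Submodule.smul_mem _ a hx.1, by
    rw [Algebra.smul_def, map_mul]
    exact (mul_le_of_le_one_left' (val_algebraMap_le_one R K a)).trans hx.2⟩

/-- The type sequence: `r_i = ℓ((R : R_i) / (R : R_{i-1}))`, for `1 ≤ i ≤ n`. -/
def typeSeq (i : ℕ) : ℕ := len (dual (filt R K i)) (dual (filt R K (i - 1)))

variable {R K}

open Classical in
/-- `Γ = {i ∈ {1, …, n} | s_{i-1} ∈ v(J)}`; used for `J = R : Λ`. -/
def Gam (J : Submodule R K) : Finset ℕ :=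
  (Finset.Icc 1 (typeLength R K)).filter fun i => (semi R K (i - 1) : ℤ) ∈ valueSet J

/-- `d(J) = ℓ(intCl R K / (R : J)) - ∑_{i ∈ Γ} r_i`; for `J = R : Λ` one has `R : J = Λ**`. -/
def dInv (J : Submodule R K) : ℤ :=
  (len (intCl R K) (dual J) : ℤ) - ∑ i ∈ Gam J, (typeSeq R K i : ℤ)

end Valuation

/-! ### Invariants of an ideal -/

section IdealInvariants

variable {R : Type*} [CommRing R]

/-- `x` is a minimal reduction of `I`: `x ∈ I` and `I^(n+1) = x I^n` for `n ≫ 0`. -/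
def IsMinimalReduction (I : Ideal R) (x : R) : Prop :=
  x ∈ I ∧ ∃ N : ℕ, ∀ n ≥ N, I ^ (n + 1) = Ideal.span {x} * I ^ n

/-- The reduction exponent: the least `m` with `I^(n+1) = x I^n` for all `n ≥ m`,
where `x` is a minimal reduction of `I`. -/
def reductionExponent (I : Ideal R) (x : R) : ℕ :=
  sInf {m : ℕ | ∀ n ≥ m, I ^ (n + 1) = Ideal.span {x} * I ^ n}

/-- The Hilbert function `H_I(n) = ℓ(I^n / I^(n+1))`. -/
def hilbertFunction (I : Ideal R) (n : ℕ) : ℕ :=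
  (Module.length R (↥(I ^ n) ⧸ (I ^ (n + 1)).submoduleOf (I ^ n))).toNat

/-- The Hilbert–Poincaré series `P_I(z) = ∑ H_I(n) z^n`. -/
def hilbertSeries (I : Ideal R) : ℤ⟦X⟧ := PowerSeries.mk fun n => (hilbertFunction I n : ℤ)

open Classical in
/-- The `h`-polynomial: the polynomial `h_I` with `P_I(z) = h_I(z) / (1 - z)`. -/
def hPolynomial (I : Ideal R) : ℤ[X] :=
  if h : ∃ p : ℤ[X], (p : ℤ⟦X⟧) = (1 - PowerSeries.X) * hilbertSeries I then h.choose else 0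

/-- The multiplicity `e(I) = h_I(1)`. -/
def idealMult (I : Ideal R) : ℤ := (hPolynomial I).eval 1

/-- The genus `ρ(I) = h_I'(1)`. -/
def genus (I : Ideal R) : ℤ := (Polynomial.derivative (hPolynomial I)).eval 1

variable (K : Type*) [Field K] [Algebra R K]

/-- The power `I^n` as an `R`-submodule of `K`. -/
abbrev powK (I : Ideal R) (n : ℕ) : Submodule R K := IsLocalization.coeSubmodule K (I ^ n)

/-- The blowing-up `Λ(I) = ⋃ₙ (I^n : I^n)`; see `mem_Lam` for the fact that this supremum
is the union. -/
def Lam (I : Ideal R) : Submodule R K := ⨆ n : ℕ, powK K I n / powK K I n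

theorem powK_div_powK_mono (I : Ideal R) : Monotone fun n : ℕ => powK K I n / powK K I n := by
  refine monotone_nat_of_le_succ fun n x hx => ?_
  rw [Submodule.mem_div_iff_forall_mul_mem] at hx ⊢
  intro y hy
  have e : powK K I (n + 1) = powK K I n * powK K I 1 := by
    rw [← IsLocalization.coeSubmodule_mul, ← pow_add]
  rw [e] at hy ⊢
  induction hy using Submodule.mul_induction_on' with
  | mem_mul_mem a ha b hb => rw [← mul_assoc]; exact Submodule.mul_mem_mul (hx a ha) hb
  | add a _ b _ h1 h2 => rw [mul_add]; exact add_mem h1 h2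

theorem mem_Lam (I : Ideal R) (x : K) : x ∈ Lam K I ↔ ∃ n : ℕ, x ∈ powK K I n / powK K I n :=
  Submodule.mem_iSup_of_directed _ (powK_div_powK_mono K I).directed_le

end IdealInvariants

end BlowUp

end

/-!
Lengths are compared through the colength in `R̄`, namely `ℓ(A / B) = ℓ(R̄ / B) - ℓ(R̄ / A)`.
Residual rationality makes every step of the filtration of `J` by value have length at most `1`,
with equality exactly at the elements of `v(J)`, and multiplication by an element of value `m`
raises the colength by `m`.

Choose `x ∈ I` of least value `e`. The integers `ℓ(R̄ / I^n) - n e ≥ 0` do not increase with `n`, so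
they become stationary, which says that `I^(n+1) = x I^n` for large `n`. For any minimal reduction
`x` one has `I^ν = x^ν Λ`, and summing the Hilbert function gives `ρ = ℓ(Λ / R)`. Part (1) follows
since `∑ r_i = ℓ(R̄ / R)` telescopes and the number of `i ∉ Γ` is `ℓ(R / (R : Λ))`.

For part (2) it remains to see that `d(R : Λ) ≥ 0`. Put `J = R : Λ` and `J_i = J ∩ R_i`. For `i ∈ Γ`
one has `R_{i-1} = R_i + J_{i-1}`, whence `R : R_{i-1} = (R : R_i) ∩ (R : J_{i-1})` and
`r_i ≤ ℓ((R : J_i) / (R : J_{i-1}))`. The sum of these lengths over all `i` is `ℓ(R̄ / Λ**)`.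
-/

noncomputable section

open scoped Pointwise

namespace BlowUp

section Length

variable {R M N : Type*} [Ring R] [AddCommGroup M] [Module R M] [AddCommGroup N] [Module R N]
  {A B C A' B' : Submodule R M}

theorem mapQ_injective {p : Submodule R M} {q : Submodule R N} {f : M →ₗ[R] N}
    (h : p = q.comap f) : Function.Injective (p.mapQ q f h.le) := by
  rw [← LinearMap.ker_eq_bot, Submodule.ker_mapQ, ← h, Submodule.mkQ_map_self]

theorem length_subquotient_add (hCB : C ≤ B) (hBA : B ≤ A) :
    Module.length R (A ⧸ C.submoduleOf A) =
      Module.length R (A ⧸ B.submoduleOf A) + Module.length R (B ⧸ C.submoduleOf B) := by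
  have hC : C.submoduleOf A ≤ B.submoduleOf A := Submodule.comap_mono hCB
  have hinc : C.submoduleOf B = (C.submoduleOf A).comap (Submodule.inclusion hBA) := rfl
  rw [add_comm]
  refine Module.length_eq_add_of_exact (Submodule.mapQ _ _ (Submodule.inclusion hBA) hinc.le)
    (Submodule.factor hC) (mapQ_injective hinc) (Submodule.factor_surjective hC) ?_
  rw [LinearMap.exact_iff, Submodule.range_mapQ, Submodule.range_inclusion, Submodule.factor,
    Submodule.ker_mapQ, Submodule.comap_id]
  rfl

theorem length_subquotient_le (hA : A ≤ A') (h : A ⊓ B = A ⊓ B') :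
    Module.length R (A ⧸ B.submoduleOf A) ≤ Module.length R (A' ⧸ B'.submoduleOf A') := by
  refine Module.length_le_of_injective _
    (mapQ_injective (f := Submodule.inclusion hA) (q := B'.submoduleOf A') ?_)
  ext x
  have hx := SetLike.ext_iff.1 h (x : M)
  rwa [Submodule.mem_inf, Submodule.mem_inf, and_iff_right x.2, and_iff_right x.2] at hx

theorem length_subquotient_map {f : M →ₗ[R] N} (hf : Function.Injective f)
    (A B : Submodule R M) :
    Module.length R (A.map f ⧸ (B.map f).submoduleOf (A.map f)) =
      Module.length R (A ⧸ B.submoduleOf A) := by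
  refine (Submodule.Quotient.equiv _ _ (Submodule.equivMapOfInjective f hf A) ?_).length_eq.symm
  ext y
  obtain ⟨x, rfl⟩ := (Submodule.equivMapOfInjective f hf A).surjective y
  rw [Submodule.mem_map_equiv, LinearEquiv.symm_apply_apply]
  exact (hf.mem_set_image (s := (B : Set M))).symm

theorem length_subquotient_eq_zero_iff : Module.length R (A ⧸ B.submoduleOf A) = 0 ↔ A ≤ B := by
  rw [Module.length_eq_zero_iff, Submodule.Quotient.subsingleton_iff, Submodule.submoduleOf_eq_top]

theorem length_subquotient_eq_one (hAB : ¬A ≤ B)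
    (h : ∀ x ∈ A, x ∉ B → ∀ z ∈ A, ∃ r : R, z - r • x ∈ B) :
    Module.length R (A ⧸ B.submoduleOf A) = 1 := by
  rw [Module.length_eq_one_iff, isSimpleModule_iff_toSpanSingleton_surjective]
  refine ⟨?_, fun x hx z => ?_⟩
  · rwa [← not_subsingleton_iff_nontrivial, ← Module.length_eq_zero_iff (R := R),
      length_subquotient_eq_zero_iff]
  · obtain ⟨x, rfl⟩ := Submodule.Quotient.mk_surjective _ x
    obtain ⟨z, rfl⟩ := Submodule.Quotient.mk_surjective _ z
    rw [Ne, Submodule.Quotient.mk_eq_zero] at hx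
    obtain ⟨r, hr⟩ := h x x.2 hx z z.2
    exact ⟨r, ((Submodule.Quotient.eq (B.submoduleOf A)).2 hr).symm⟩

end Length

section Dual

variable {R : Type*} [CommRing R] {K : Type*} [Field K] [Algebra R K] {A B J : Submodule R K}

theorem mem_dual {x : K} : x ∈ dual J ↔ ∀ y ∈ J, x * y ∈ base R K :=
  Submodule.mem_div_iff_forall_mul_mem

theorem dual_anti (h : A ≤ B) : dual B ≤ dual A :=
  fun _ hx => mem_dual.2 fun y hy => mem_dual.1 hx y (h hy)

theorem le_dual_dual (J : Submodule R K) : J ≤ dual (dual J) :=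
  fun x hx => mem_dual.2 fun y hy => mul_comm y x ▸ mem_dual.1 hy x hx

theorem dual_sup (A B : Submodule R K) : dual (A ⊔ B) = dual A ⊓ dual B := by
  refine le_antisymm (le_inf (dual_anti le_sup_left) (dual_anti le_sup_right)) ?_
  rintro x ⟨hA, hB⟩
  refine mem_dual.2 fun y hy => ?_
  obtain ⟨a, ha, b, hb, rfl⟩ := Submodule.mem_sup.1 hy
  rw [mul_add]
  exact add_mem (mem_dual.1 hA a ha) (mem_dual.1 hB b hb)

theorem dual_smul {x : K} (hx : x ≠ 0) (J : Submodule R K) : dual (x • J) = x⁻¹ • dual J := by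
  ext y
  rw [Submodule.mem_smul_iff_inv_mul_mem (inv_ne_zero hx), inv_inv, mem_dual, mem_dual]
  constructor
  · intro h z hz
    rw [mul_right_comm, mul_comm]
    exact h _ (Submodule.smul_mem_pointwise_smul z x J hz)
  · intro h z hz
    have := h _ ((Submodule.mem_smul_iff_inv_mul_mem hx).1 hz)
    rwa [mul_mul_mul_comm, mul_inv_cancel₀ hx, one_mul] at this

theorem base_le_intCl : base R K ≤ intCl R K :=
  Submodule.one_le.2 (integralClosure R K).one_mem

theorem dual_le_base (h : base R K ≤ J) : dual J ≤ base R K := fun x hx => by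
  simpa only [mul_one] using mem_dual.1 hx 1 (Submodule.one_le.1 h)

theorem dual_base : dual (base R K) = base R K :=
  le_antisymm (dual_le_base le_rfl) fun _ hx => mem_dual.2 fun _ hy => by
    simpa only [one_mul] using Submodule.mul_mem_mul hx hy

theorem base_le_dual (h : J ≤ base R K) : base R K ≤ dual J :=
  dual_base.ge.trans (dual_anti h)

theorem conductor_le_base : conductor R K ≤ base R K := dual_le_base base_le_intCl

theorem conductor_mul_intCl_le : conductor R K * intCl R K ≤ conductor R K :=
  Submodule.mul_le.2 fun g hg s hs => mem_dual.2 fun y hy => by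
    rw [mul_assoc]
    exact mem_dual.1 hg _ ((integralClosure R K).mul_mem hs hy)

theorem smul_intCl_le_conductor {g : K} (hg : g ∈ conductor R K) :
    g • intCl R K ≤ conductor R K := by
  rw [← Submodule.span_singleton_mul]
  exact (mul_le_mul_left ((Submodule.span_singleton_le_iff_mem _ _).2 hg) _).trans
    conductor_mul_intCl_le

theorem dual_conductor_le : dual (conductor R K) ≤ conductor R K / conductor R K :=
  fun y hy => Submodule.mem_div_iff_forall_mul_mem.2 fun g hg => mem_dual.2 fun s hs => by
    rw [mul_assoc]
    exact mem_dual.1 hy _ (conductor_mul_intCl_le (Submodule.mul_mem_mul hg hs))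

theorem smul_ne_bot {x : K} (hx : x ≠ 0) (hA : A ≠ ⊥) : x • A ≠ ⊥ := by
  obtain ⟨a, ha, ha0⟩ := Submodule.exists_mem_ne_zero_of_ne_bot hA
  exact (Submodule.ne_bot_iff _).2
    ⟨x * a, Submodule.smul_mem_pointwise_smul a x A ha, mul_ne_zero hx ha0⟩

theorem len_smul {x : K} (hx : x ≠ 0) (A B : Submodule R K) : len (x • A) (x • B) = len A B := by
  rw [len, len, Submodule.pointwise_smul_def, Submodule.pointwise_smul_def, length_subquotient_map]
  exact mul_right_injective₀ hx

variable (R K) in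
/-- The colength `ℓ(R̄ / A)` of a submodule of the integral closure `R̄`. It is an integer because
it enters through differences: `ℓ(A / B) = ℓ(R̄ / B) - ℓ(R̄ / A)`. -/
def colen (A : Submodule R K) : ℤ := len (intCl R K) A

theorem colen_intCl : colen R K (intCl R K) = 0 := by
  rw [colen, len, length_subquotient_eq_zero_iff.2 le_rfl, ENat.toNat_zero, Nat.cast_zero]

end Dual

section Hilbert

theorem one_sub_X_mul_eq_of_eventually_const {S : Type*} [CommRing S] {f : S⟦X⟧} {N : ℕ} {e : S}
    (h : ∀ n ≥ N, f.coeff n = e) :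
    (((1 - Polynomial.X) * f.trunc N + Polynomial.C e * Polynomial.X ^ N : S[X]) : S⟦X⟧) =
      (1 - PowerSeries.X) * f := by
  have hf : f = (f.trunc N : S⟦X⟧) + PowerSeries.C e * (PowerSeries.X ^ N * PowerSeries.mk 1) := by
    ext n
    rw [map_add, PowerSeries.coeff_C_mul, PowerSeries.coeff_X_pow_mul', Polynomial.coeff_coe,
      PowerSeries.coeff_trunc]
    rcases lt_or_ge n N with hn | hn
    · simp only [hn, hn.not_ge, if_true, if_false, mul_zero, add_zero]
    · simp only [hn, hn.not_gt, h n hn, if_true, if_false, PowerSeries.coeff_mk, Pi.one_apply,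
        mul_one, zero_add]
  conv_rhs => rw [hf]
  push_cast
  linear_combination
    -(PowerSeries.C e * PowerSeries.X ^ N) * PowerSeries.mk_one_mul_one_sub_eq_one S

theorem eval_one_derivative {S : Type*} [CommRing S] (p : S[X]) (e : S) (N : ℕ) :
    (Polynomial.derivative
      ((1 - Polynomial.X) * p + Polynomial.C e * Polynomial.X ^ N)).eval 1 = e * N - p.eval 1 := by
  simp [Polynomial.derivative_X_pow, neg_add_eq_sub]

variable {R : Type*} [CommRing R] {I : Ideal R} {N : ℕ} {e : ℤ}

theorem hPolynomial_eq (h : ∀ n ≥ N, (hilbertFunction I n : ℤ) = e) :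
    hPolynomial I = (1 - Polynomial.X) * (hilbertSeries I).trunc N +
      Polynomial.C e * Polynomial.X ^ N := by
  have hcoeff : ∀ n ≥ N, (hilbertSeries I).coeff n = e := fun n hn => by
    rw [hilbertSeries, PowerSeries.coeff_mk, h n hn]
  have hex : ∃ p : ℤ[X], (p : ℤ⟦X⟧) = (1 - PowerSeries.X) * hilbertSeries I :=
    ⟨_, one_sub_X_mul_eq_of_eventually_const hcoeff⟩
  rw [hPolynomial, dif_pos hex]
  exact Polynomial.coe_injective ℤ
    (hex.choose_spec.trans (one_sub_X_mul_eq_of_eventually_const hcoeff).symm)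

theorem idealMult_eq (h : ∀ n ≥ N, (hilbertFunction I n : ℤ) = e) : idealMult I = e := by
  simp [idealMult, hPolynomial_eq h]

theorem genus_eq (h : ∀ n ≥ N, (hilbertFunction I n : ℤ) = e) :
    genus I = e * N - ∑ n ∈ Finset.range N, (hilbertFunction I n : ℤ) := by
  have htrunc : ((hilbertSeries I).trunc N).eval 1 =
      ∑ n ∈ Finset.range N, (hilbertFunction I n : ℤ) := by
    simp [Polynomial.eval, PowerSeries.eval₂_trunc_eq_sum_range, hilbertSeries]
  rw [genus, hPolynomial_eq h, eval_one_derivative, htrunc]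

end Hilbert

section Valuation

variable (R : Type*) [CommRing R] [IsDomain R] (K : Type*) [Field K] [Algebra R K]
  [IsFractionRing R K] [IsDiscreteValuationRing (integralClosure R K)]

/-- The fractional ideal `{x ∈ K | v(x) ≥ m}` of the integral closure, as an `R`-submodule. -/
def valGE (m : ℤ) : Submodule R K where
  carrier := {x | val R K x ≤ WithZero.exp (-m)}
  zero_mem' := by simp
  add_mem' := (val R K).map_add_le
  smul_mem' := fun a x hx => by
    rw [Set.mem_ofPred_eq, Algebra.smul_def, map_mul]
    exact (mul_le_of_le_one_left' (val_algebraMap_le_one R K a)).trans hx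

variable {R K} {J : Submodule R K} {m n : ℤ} {x z : K}

theorem mem_valGE : x ∈ valGE R K m ↔ val R K x ≤ WithZero.exp (-m) := Iff.rfl

theorem valGE_anti : Antitone (valGE R K) :=
  fun _ _ h _ hx => hx.trans (WithZero.exp_le_exp.2 (neg_le_neg h))

theorem exists_val_eq_exp (hx : x ≠ 0) : ∃ n : ℤ, val R K x = WithZero.exp (-n) :=
  ⟨-(val R K x).log, by rw [neg_neg, WithZero.exp_log ((val R K).ne_zero_iff.2 hx)]⟩

theorem ne_zero_of_val_eq_exp (hx : val R K x = WithZero.exp n) : x ≠ 0 :=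
  (val R K).ne_zero_iff.1 (hx ▸ WithZero.exp_ne_zero)

theorem mem_valGE_add_one : x ∈ valGE R K (m + 1) ↔ val R K x < WithZero.exp (-m) := by
  rw [mem_valGE, ← WithZero.lt_mul_exp_iff_le WithZero.exp_ne_zero, ← WithZero.exp_add,
    neg_add, neg_add_cancel_right]

theorem val_le_one_iff : val R K x ≤ 1 ↔ x ∈ intCl R K := by
  have := isFractionRing_intCl R K
  constructor
  · intro hx
    obtain ⟨y, rfl⟩ := IsDiscreteValuationRing.exists_lift_of_le_one hx
    exact y.2
  · exact fun hx => (IsDiscreteValuationRing.maximalIdeal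
      (integralClosure R K)).valuation_le_one (K := K) ⟨x, hx⟩

theorem valGE_zero : valGE R K 0 = intCl R K := by
  ext x
  rw [mem_valGE, neg_zero, WithZero.exp_zero, val_le_one_iff]

theorem valGE_natCast_le_intCl (n : ℕ) : valGE R K n ≤ intCl R K :=
  (valGE_anti n.cast_nonneg).trans valGE_zero.le

variable (R K) in
theorem exists_val_eq (n : ℤ) : ∃ x : K, val R K x = WithZero.exp (-n) :=
  haveI := isFractionRing_intCl R K
  (IsDiscreteValuationRing.maximalIdeal (integralClosure R K)).valuation_surjective K _

theorem valGE_ne_bot (n : ℤ) : valGE R K n ≠ ⊥ := by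
  obtain ⟨x, hx⟩ := exists_val_eq R K n
  exact (Submodule.ne_bot_iff _).2 ⟨x, hx.le, ne_zero_of_val_eq_exp hx⟩

theorem exists_val_eq_exp_natCast (hx : x ∈ intCl R K) (hx0 : x ≠ 0) :
    ∃ n : ℕ, val R K x = WithZero.exp (-(n : ℤ)) := by
  obtain ⟨n, hn⟩ := exists_val_eq_exp (R := R) hx0
  rw [← val_le_one_iff, hn, ← WithZero.exp_zero, WithZero.exp_le_exp, neg_nonpos] at hx
  lift n to ℕ using hx
  exact ⟨n, hn⟩

theorem smul_valGE (hx : val R K x = WithZero.exp (-m)) (n : ℤ) :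
    x • valGE R K n = valGE R K (m + n) := by
  ext y
  rw [Submodule.mem_smul_iff_inv_mul_mem (ne_zero_of_val_eq_exp hx), mem_valGE, mem_valGE,
    map_mul, map_inv₀, hx, inv_mul_le_iff₀ WithZero.exp_pos, ← WithZero.exp_add, neg_add]

theorem smul_intCl (hx : val R K x = WithZero.exp (-m)) : x • intCl R K = valGE R K m := by
  rw [← valGE_zero, smul_valGE hx, add_zero]

theorem valGE_mul_le (m n : ℤ) : valGE R K m * valGE R K n ≤ valGE R K (m + n) :=
  Submodule.mul_le.2 fun a ha b hb => by
    rw [mem_valGE, map_mul, neg_add, WithZero.exp_add]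
    exact mul_le_mul' ha hb

theorem exists_val_eq_exp_and_le_valGE (hJ : J ≤ intCl R K) (hJ0 : J ≠ ⊥) :
    ∃ x ∈ J, ∃ m : ℕ, val R K x = WithZero.exp (-(m : ℤ)) ∧ J ≤ valGE R K m := by
  let S : Set ℕ := {n | ∃ x ∈ J, val R K x = WithZero.exp (-(n : ℤ))}
  have hS : S.Nonempty := by
    obtain ⟨y, hy, hy0⟩ := Submodule.exists_mem_ne_zero_of_ne_bot hJ0
    obtain ⟨n, hn⟩ := exists_val_eq_exp_natCast (hJ hy) hy0
    exact ⟨n, y, hy, hn⟩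
  obtain ⟨x, hx, hxv⟩ := Nat.sInf_mem hS
  refine ⟨x, hx, sInf S, hxv, fun y hy => ?_⟩
  rcases eq_or_ne y 0 with rfl | hy0
  · exact zero_mem _
  · obtain ⟨n, hn⟩ := exists_val_eq_exp_natCast (hJ hy) hy0
    rw [mem_valGE, hn, WithZero.exp_le_exp, neg_le_neg_iff]
    exact_mod_cast Nat.sInf_le (s := S) ⟨y, hy, hn⟩

theorem div_self_le_intCl (hJ : J ≤ intCl R K) (hJ0 : J ≠ ⊥) : J / J ≤ intCl R K := by
  intro y hy
  obtain ⟨x, hx, m, hxm, hJm⟩ := exists_val_eq_exp_and_le_valGE hJ hJ0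
  have hyx : val R K (y * x) ≤ val R K x :=
    hxm ▸ hJm (Submodule.mem_div_iff_forall_mul_mem.1 hy x hx)
  rw [map_mul] at hyx
  exact val_le_one_iff.1
    ((mul_le_iff_le_one_left (hxm ▸ WithZero.exp_pos)).1 hyx)

theorem exists_sub_smul_mem_valGE (hres : ResiduallyRational R K)
    (hx : val R K x = WithZero.exp (-m)) (hz : z ∈ valGE R K m) :
    ∃ r : R, z - r • x ∈ valGE R K (m + 1) := by
  have := isFractionRing_intCl R K
  rw [← smul_intCl hx] at hz
  obtain ⟨u, hu, rfl⟩ := (Submodule.mem_smul_pointwise_iff_exists _ _ _).1 hz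
  obtain ⟨r, hr⟩ := hres (IsLocalRing.residue (integralClosure R K) ⟨u, hu⟩)
  rw [RingHom.comp_apply, eq_comm, ← sub_eq_zero, ← map_sub, IsLocalRing.residue_eq_zero_iff] at hr
  have hur : val R K (u - algebraMap R K r) < 1 :=
    ((IsDiscreteValuationRing.maximalIdeal
      (integralClosure R K)).valuation_lt_one_iff_mem (K := K) _).2 hr
  refine ⟨r, mem_valGE_add_one.2 ?_⟩
  rw [smul_eq_mul, Algebra.smul_def, mul_comm, ← sub_mul, map_mul, hx]
  exact mul_lt_of_lt_one_left WithZero.exp_pos hur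

open Classical in
theorem length_inf_valGE (hres : ResiduallyRational R K) (J : Submodule R K) (m : ℤ) :
    Module.length R (↥(J ⊓ valGE R K m) ⧸ (J ⊓ valGE R K (m + 1)).submoduleOf (J ⊓ valGE R K m)) =
      if m ∈ valueSet J then 1 else 0 := by
  split_ifs with hm
  · obtain ⟨y, hyJ, hy⟩ := hm
    refine length_subquotient_eq_one (fun h => ?_) ?_
    · exact (mem_valGE_add_one.1 (h ⟨hyJ, hy.le⟩).2).ne hy
    · rintro x ⟨hxJ, hxm⟩ hx z ⟨hzJ, hzm⟩
      have hxv : val R K x = WithZero.exp (-m) :=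
        hxm.eq_of_not_lt fun hlt => hx ⟨hxJ, mem_valGE_add_one.2 hlt⟩
      obtain ⟨r, hr⟩ := exists_sub_smul_mem_valGE hres hxv hzm
      exact ⟨r, sub_mem hzJ (J.smul_mem r hxJ), hr⟩
  · rw [length_subquotient_eq_zero_iff]
    exact fun x hx => ⟨hx.1, mem_valGE_add_one.2 (hx.2.lt_of_ne fun h => hm ⟨x, hx.1, h⟩)⟩

theorem length_intCl_valGE (hres : ResiduallyRational R K) (n : ℕ) :
    Module.length R (intCl R K ⧸ (valGE R K n).submoduleOf (intCl R K)) = n := by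
  induction n with
  | zero => rw [length_subquotient_eq_zero_iff.2 valGE_zero.ge, Nat.cast_zero]
  | succ n ih =>
    have hgr := length_inf_valGE hres (⊤ : Submodule R K) n
    obtain ⟨x, hx⟩ := exists_val_eq R K n
    rw [if_pos ⟨x, trivial, hx⟩, top_inf_eq, top_inf_eq] at hgr
    push_cast
    rw [length_subquotient_add (valGE_anti (lt_add_one _).le) (valGE_natCast_le_intCl n), ih, hgr]

theorem colen_valGE (hres : ResiduallyRational R K) (n : ℕ) : colen R K (valGE R K n) = n := by
  rw [colen, len, length_intCl_valGE hres, ENat.toNat_natCast]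

end Valuation

section Colength

variable {R : Type*} [CommRing R] [IsDomain R] {K : Type*} [Field K] [Algebra R K]
  [IsFractionRing R K] [Module.Finite R (integralClosure R K)]

variable (R K) in
theorem conductor_ne_bot : conductor R K ≠ ⊥ := by
  have hfg : (intCl R K).FG := by
    rw [← Submodule.fg_top, ← Module.finite_def]
    exact inferInstanceAs (Module.Finite R (integralClosure R K))
  obtain ⟨a, ha, h⟩ := FractionalIdeal.isFractional_of_fg (S := nonZeroDivisors R) hfg
  refine (Submodule.ne_bot_iff _).2 ⟨algebraMap R K a, mem_dual.2 fun y hy => ?_,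
    IsFractionRing.to_map_ne_zero_of_mem_nonZeroDivisors ha⟩
  rw [← Algebra.smul_def]
  exact Submodule.mem_one.2 (h y hy)

theorem base_ne_bot : base R K ≠ ⊥ := ne_bot_of_le_ne_bot (conductor_ne_bot R K) conductor_le_base

variable [IsDiscreteValuationRing (integralClosure R K)] {A B A' B' J : Submodule R K} {x : K}

variable (R K) in
theorem exists_conductor_eq_valGE : ∃ c : ℕ, conductor R K = valGE R K c := by
  obtain ⟨g, hg, c, hgc, hle⟩ := exists_val_eq_exp_and_le_valGE
    (conductor_le_base.trans base_le_intCl) (conductor_ne_bot R K)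
  exact ⟨c, hle.antisymm (smul_intCl hgc ▸ smul_intCl_le_conductor hg)⟩

theorem dual_conductor : dual (conductor R K) = intCl R K :=
  (dual_conductor_le.trans (div_self_le_intCl (conductor_le_base.trans base_le_intCl)
    (conductor_ne_bot R K))).antisymm (le_dual_dual _)

theorem dual_le_intCl (hJ : conductor R K ≤ J) : dual J ≤ intCl R K :=
  (dual_anti hJ).trans dual_conductor.le

theorem exists_valGE_le (hA : A ≠ ⊥) : ∃ n : ℕ, valGE R K n ≤ A := by
  obtain ⟨a, ha, ha0⟩ := Submodule.exists_mem_ne_zero_of_ne_bot hA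
  obtain ⟨m, hm⟩ := exists_val_eq_exp (R := R) ha0
  obtain ⟨c, hc⟩ := exists_conductor_eq_valGE R K
  refine ⟨(m + c).toNat, (valGE_anti (Int.self_le_toNat _)).trans ?_⟩
  rw [← smul_valGE hm, ← hc]
  refine (Submodule.map_mono conductor_le_base).trans ?_
  rintro _ ⟨b, hb, rfl⟩
  obtain ⟨r, rfl⟩ := Submodule.mem_one.1 hb
  simpa only [DistribSMul.toLinearMap_apply, smul_eq_mul, mul_comm a, ← Algebra.smul_def]
    using A.smul_mem r ha

theorem inf_valGE_ne_bot (hA : A ≠ ⊥) (m : ℤ) : A ⊓ valGE R K m ≠ ⊥ := by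
  obtain ⟨n, hn⟩ := exists_valGE_le hA
  exact ne_bot_of_le_ne_bot (valGE_ne_bot (max n m))
    (le_inf ((valGE_anti (le_max_left _ _)).trans hn) (valGE_anti (le_max_right _ _)))

theorem length_subquotient_ne_top (hres : ResiduallyRational R K) (hA : A ≤ intCl R K)
    (hB : B ≠ ⊥) : Module.length R (A ⧸ B.submoduleOf A) ≠ ⊤ := by
  obtain ⟨n, hn⟩ := exists_valGE_le (inf_valGE_ne_bot hB 0)
  rw [valGE_zero] at hn
  have hlen := length_intCl_valGE hres n
  rw [length_subquotient_add hn inf_le_right] at hlen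
  have htop := ne_top_of_le_ne_top (ENat.natCast_ne_top n) (le_self_add.trans hlen.le)
  refine ne_top_of_le_ne_top htop (length_subquotient_le hA ?_)
  rw [inf_comm B, ← inf_assoc, inf_eq_left.2 hA]

theorem len_eq_zero_iff (hres : ResiduallyRational R K) (hA : A ≤ intCl R K) (hB : B ≠ ⊥) :
    len A B = 0 ↔ A ≤ B := by
  rw [len, ENat.toNat_eq_zero, or_iff_left (length_subquotient_ne_top hres hA hB),
    length_subquotient_eq_zero_iff]

theorem len_le_len (hres : ResiduallyRational R K) (hA : A ≤ A') (h : A ⊓ B = A ⊓ B')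
    (hA' : A' ≤ intCl R K) (hB' : B' ≠ ⊥) : len A B ≤ len A' B' :=
  ENat.toNat_le_toNat (length_subquotient_le hA h) (length_subquotient_ne_top hres hA' hB')

theorem len_eq_colen_sub (hres : ResiduallyRational R K) (hB : B ≠ ⊥) (hBA : B ≤ A)
    (hA : A ≤ intCl R K) : (len A B : ℤ) = colen R K B - colen R K A := by
  rw [eq_sub_iff_add_eq', colen, colen, len, len, len, length_subquotient_add hBA hA,
    ENat.toNat_add (length_subquotient_ne_top hres le_rfl (ne_bot_of_le_ne_bot hB hBA))
      (length_subquotient_ne_top hres hA hB), Nat.cast_add]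

theorem colen_anti (hres : ResiduallyRational R K) (hB : B ≠ ⊥) (hBA : B ≤ A)
    (hA : A ≤ intCl R K) : colen R K A ≤ colen R K B :=
  sub_nonneg.1 (len_eq_colen_sub hres hB hBA hA ▸ Nat.cast_nonneg _)

theorem eq_of_colen_eq (hres : ResiduallyRational R K) (hB : B ≠ ⊥) (hBA : B ≤ A)
    (hA : A ≤ intCl R K) (h : colen R K A = colen R K B) : A = B := by
  have hlen := len_eq_colen_sub hres hB hBA hA
  rw [h, sub_self, Nat.cast_eq_zero, len_eq_zero_iff hres hA hB] at hlen
  exact hlen.antisymm hBA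

theorem colen_smul (hres : ResiduallyRational R K) {m : ℕ}
    (hx : val R K x = WithZero.exp (-(m : ℤ))) (hA : A ≤ intCl R K) (hA0 : A ≠ ⊥) :
    colen R K (x • A) = colen R K A + m := by
  have hx0 := ne_zero_of_val_eq_exp hx
  have hle : x • A ≤ x • intCl R K := Submodule.map_mono hA
  have hlen := len_eq_colen_sub hres (smul_ne_bot hx0 hA0) hle
    ((smul_intCl hx).trans_le (valGE_natCast_le_intCl m))
  rw [len_smul hx0, smul_intCl hx, colen_valGE hres, eq_sub_iff_add_eq] at hlen
  exact hlen.symm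

end Colength

theorem sum_Icc_one_sub {G : Type*} [AddCommGroup G] (f : ℕ → G) (n : ℕ) :
    ∑ i ∈ Finset.Icc 1 n, (f i - f (i - 1)) = f n - f 0 := by
  induction n with
  | zero => simp
  | succ n ih => rw [Finset.sum_Icc_succ_top (by lia), ih, Nat.add_sub_cancel, sub_add_sub_cancel']

section TypeSequence

variable {R : Type*} [CommRing R] [IsDomain R] {K : Type*} [Field K] [Algebra R K]
  [IsFractionRing R K] [IsDiscreteValuationRing (integralClosure R K)] {J : Submodule R K} {i : ℕ}

/-- The truncation `J_i = {x ∈ J | v(x) ≥ s_i}` of `J` at the `i`-th element of `v(R)`; for `J = R`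
it is `R_i`. -/
def trunc (J : Submodule R K) (i : ℕ) : Submodule R K := J ⊓ valGE R K (semi R K i)

theorem filt_eq_trunc (i : ℕ) : filt R K i = trunc (base R K) i := rfl

theorem trunc_mono (i : ℕ) : Monotone fun J : Submodule R K => trunc J i :=
  fun _ _ h => inf_le_inf_right _ h

theorem semi_zero : semi R K 0 = 0 := by
  rw [semi, Nat.nth_zero]
  refine Nat.sInf_eq_zero.2 (Or.inl ⟨1, Submodule.one_le.1 le_rfl, ?_⟩)
  rw [map_one, Nat.cast_zero, neg_zero, WithZero.exp_zero]

theorem trunc_zero (hJ : J ≤ base R K) : trunc J 0 = J := by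
  rw [trunc, semi_zero, Nat.cast_zero, valGE_zero, inf_eq_left.2 (hJ.trans base_le_intCl)]

theorem Gam_subset (J : Submodule R K) : Gam J ⊆ Finset.Icc 1 (typeLength R K) := by
  classical exact Finset.filter_subset _ _

variable [Module.Finite R (integralClosure R K)]

variable (R K) in
theorem infinite_values : (Set.ofPred fun m : ℕ => (m : ℤ) ∈ valueSet (base R K)).Infinite := by
  obtain ⟨c, hc⟩ := exists_conductor_eq_valGE R K
  refine Set.infinite_of_forall_exists_gt fun n => ⟨max c (n + 1), ?_,
    (Nat.lt_succ_self n).trans_le (le_max_right _ _)⟩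
  obtain ⟨x, hx⟩ := exists_val_eq R K (max c (n + 1) : ℕ)
  have hxc : x ∈ valGE R K c := valGE_anti (by exact_mod_cast le_max_left c (n + 1)) hx.le
  exact ⟨x, conductor_le_base (hc.ge hxc), hx⟩

theorem semi_mem (i : ℕ) : (semi R K i : ℤ) ∈ valueSet (base R K) :=
  Nat.nth_mem_of_infinite (infinite_values R K) i

theorem semi_strictMono : StrictMono (semi R K) := Nat.nth_strictMono (infinite_values R K)

theorem trunc_anti (J : Submodule R K) : Antitone (trunc J) :=
  fun _ _ h => inf_le_inf_left _ (valGE_anti (Nat.cast_le.2 (semi_strictMono.monotone h)))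

theorem inf_valGE_semi_add_one (hJ : J ≤ base R K) (i : ℕ) :
    J ⊓ valGE R K (semi R K i + 1) = trunc J (i + 1) := by
  have hlt : semi R K i < semi R K (i + 1) := semi_strictMono i.lt_add_one
  refine le_antisymm (fun x hx => ⟨hx.1, ?_⟩) (inf_le_inf_left _ (valGE_anti (by lia)))
  rcases eq_or_ne x 0 with rfl | hx0
  · exact zero_mem _
  obtain ⟨m, hm⟩ := exists_val_eq_exp_natCast (base_le_intCl (hJ hx.1)) hx0
  have him := mem_valGE_add_one.1 hx.2
  rw [hm, WithZero.exp_lt_exp, neg_lt_neg_iff, Nat.cast_lt] at him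
  have hle : semi R K (i + 1) ≤ m := by
    by_contra! hlt'
    exact him.not_ge (Nat.le_nth_of_lt_nth_succ hlt' ⟨x, hJ hx.1, hm⟩)
  refine mem_valGE.2 ?_
  rw [hm, WithZero.exp_le_exp]
  lia

open Classical in
theorem len_trunc_succ (hres : ResiduallyRational R K) (hJ : J ≤ base R K) (i : ℕ) :
    len (trunc J i) (trunc J (i + 1)) = if (semi R K i : ℤ) ∈ valueSet J then 1 else 0 := by
  rw [len, ← inf_valGE_semi_add_one hJ, trunc, length_inf_valGE hres]
  split_ifs <;> rfl

theorem sum_len_trunc (hres : ResiduallyRational R K) (hJ : J ≤ base R K) (hJ0 : J ≠ ⊥) (k : ℕ) :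
    ∑ i ∈ Finset.Icc 1 k, (len (trunc J (i - 1)) (trunc J i) : ℤ) =
      colen R K (trunc J k) - colen R K J := by
  calc
    _ = ∑ i ∈ Finset.Icc 1 k, (colen R K (trunc J i) - colen R K (trunc J (i - 1))) :=
      Finset.sum_congr rfl fun i _ => len_eq_colen_sub hres (inf_valGE_ne_bot hJ0 _)
        (trunc_anti J (i.sub_le 1)) (inf_le_left.trans (hJ.trans base_le_intCl))
    _ = _ := by rw [sum_Icc_one_sub fun i => colen R K (trunc J i), trunc_zero hJ]

theorem colen_filt (hres : ResiduallyRational R K) (k : ℕ) :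
    colen R K (filt R K k) = colen R K (base R K) + k := by
  have hstep : ∀ i ∈ Finset.Icc 1 k,
      (len (trunc (base R K) (i - 1)) (trunc (base R K) i) : ℤ) = 1 := fun i hi => by
    obtain ⟨j, rfl⟩ := Nat.exists_eq_add_of_le' (Finset.mem_Icc.1 hi).1
    rw [Nat.add_sub_cancel, len_trunc_succ hres le_rfl,
      if_pos (semi_mem j), Nat.cast_one]
  have hsum := sum_len_trunc hres le_rfl (base_ne_bot (R := R) (K := K)) k
  rw [← filt_eq_trunc, Finset.sum_congr rfl hstep, Finset.sum_const, Nat.card_Icc,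
    Nat.add_sub_cancel, nsmul_one] at hsum
  exact (sub_eq_iff_eq_add'.1 hsum.symm)

theorem conductor_eq_valGE (hres : ResiduallyRational R K) :
    conductor R K = valGE R K (semi R K (typeLength R K)) := by
  obtain ⟨g, hg, c, hgc, hle⟩ := exists_val_eq_exp_and_le_valGE
    (conductor_le_base.trans base_le_intCl) (conductor_ne_bot R K)
  have hc : conductor R K = valGE R K c :=
    hle.antisymm (smul_intCl hgc ▸ smul_intCl_le_conductor hg)
  classical
  obtain ⟨j, rfl⟩ : ∃ j, semi R K j = c := ⟨_, Nat.nth_count ⟨g, conductor_le_base hg, hgc⟩⟩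
  have hfilt : filt R K j = conductor R K := by
    rw [filt_eq_trunc, trunc, ← hc, inf_eq_right.2 conductor_le_base]
  have hlen := len_eq_colen_sub hres (conductor_ne_bot R K) conductor_le_base base_le_intCl
  rw [← hfilt, colen_filt hres, add_sub_cancel_left, hfilt, Nat.cast_inj] at hlen
  rwa [typeLength, hlen]

theorem trunc_typeLength (hres : ResiduallyRational R K) (hJ : conductor R K ≤ J) :
    trunc J (typeLength R K) = conductor R K := by
  rw [trunc, ← conductor_eq_valGE hres, inf_eq_right.2 hJ]

theorem conductor_le_trunc (hres : ResiduallyRational R K) (hJ : conductor R K ≤ J)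
    (hi : i ≤ typeLength R K) : conductor R K ≤ trunc J i :=
  (trunc_typeLength hres hJ).ge.trans (trunc_anti J hi)

theorem card_Gam (hres : ResiduallyRational R K) (hJ : conductor R K ≤ J) (hJR : J ≤ base R K) :
    ((Gam J).card : ℤ) = colen R K (conductor R K) - colen R K J := by
  classical
  have hsum := sum_len_trunc hres hJR (ne_bot_of_le_ne_bot (conductor_ne_bot R K) hJ)
    (typeLength R K)
  rw [trunc_typeLength hres hJ] at hsum
  rw [← hsum, Gam, Finset.natCast_card_filter]
  refine Finset.sum_congr rfl fun i hi => ?_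
  obtain ⟨j, rfl⟩ := Nat.exists_eq_add_of_le' (Finset.mem_Icc.1 hi).1
  rw [Nat.add_sub_cancel, len_trunc_succ hres hJR]
  exact (Nat.cast_ite _ _ _).symm

theorem card_sdiff_Gam (hres : ResiduallyRational R K) (hJ : conductor R K ≤ J)
    (hJR : J ≤ base R K) :
    ((Finset.Icc 1 (typeLength R K) \ Gam J).card : ℤ) = colen R K J - colen R K (base R K) := by
  rw [Finset.cast_card_sdiff (Gam_subset J), card_Gam hres hJ hJR, Nat.card_Icc,
    Nat.add_sub_cancel, typeLength,
    len_eq_colen_sub hres (conductor_ne_bot R K) conductor_le_base base_le_intCl]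
  ring

theorem dual_trunc_ne_bot (hJR : J ≤ base R K) (i : ℕ) : dual (trunc J i) ≠ ⊥ :=
  ne_bot_of_le_ne_bot base_ne_bot (base_le_dual (inf_le_left.trans hJR))

theorem sum_len_dual_trunc (hres : ResiduallyRational R K) (hJ : conductor R K ≤ J)
    (hJR : J ≤ base R K) :
    ∑ i ∈ Finset.Icc 1 (typeLength R K), (len (dual (trunc J i)) (dual (trunc J (i - 1))) : ℤ) =
      colen R K (dual J) := by
  calc
    _ = ∑ i ∈ Finset.Icc 1 (typeLength R K),
          (-colen R K (dual (trunc J i)) - -colen R K (dual (trunc J (i - 1)))) :=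
      Finset.sum_congr rfl fun i hi => by
        rw [len_eq_colen_sub hres (dual_trunc_ne_bot hJR _)
          (dual_anti (trunc_anti J (i.sub_le 1)))
          (dual_le_intCl (conductor_le_trunc hres hJ (Finset.mem_Icc.1 hi).2)), neg_sub_neg]
    _ = _ := by
      rw [sum_Icc_one_sub fun i => -colen R K (dual (trunc J i)), trunc_typeLength hres hJ,
        trunc_zero hJR, dual_conductor, colen_intCl, neg_sub_neg, sub_zero]

theorem sum_typeSeq (hres : ResiduallyRational R K) :
    ∑ i ∈ Finset.Icc 1 (typeLength R K), (typeSeq R K i : ℤ) = colen R K (base R K) :=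
  (sum_len_dual_trunc hres conductor_le_base le_rfl).trans (by rw [dual_base])

theorem filt_eq_sup (hres : ResiduallyRational R K) (hJR : J ≤ base R K)
    (hi : (semi R K i : ℤ) ∈ valueSet J) : filt R K i = filt R K (i + 1) ⊔ trunc J i := by
  refine le_antisymm (fun w hw => ?_)
    (sup_le (trunc_anti (base R K) i.le_succ) (trunc_mono i hJR))
  obtain ⟨y, hyJ, hy⟩ := hi
  obtain ⟨r, hr⟩ := exists_sub_smul_mem_valGE hres hy hw.2
  refine Submodule.mem_sup.2 ⟨w - r • y, ?_, r • y, Submodule.smul_mem _ r ⟨hyJ, hy.le⟩,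
    sub_add_cancel _ _⟩
  rw [filt_eq_trunc, ← inf_valGE_semi_add_one le_rfl]
  exact ⟨sub_mem hw.1 (Submodule.smul_mem _ r (hJR hyJ)), hr⟩

theorem typeSeq_succ_le (hres : ResiduallyRational R K) (hJ : conductor R K ≤ J)
    (hJR : J ≤ base R K) (hi : i + 1 ≤ typeLength R K) (hiJ : (semi R K i : ℤ) ∈ valueSet J) :
    typeSeq R K (i + 1) ≤ len (dual (trunc J (i + 1))) (dual (trunc J i)) := by
  refine len_le_len hres (dual_anti (trunc_mono _ hJR)) ?_
    (dual_le_intCl (conductor_le_trunc hres hJ hi)) (dual_trunc_ne_bot hJR i)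
  rw [Nat.add_sub_cancel, filt_eq_sup hres hJR hiJ, dual_sup, ← inf_assoc, inf_idem]

theorem dInv_nonneg (hres : ResiduallyRational R K) (hJ : conductor R K ≤ J)
    (hJR : J ≤ base R K) : 0 ≤ dInv J := by
  classical
  have hle : ∑ i ∈ Gam J, typeSeq R K i ≤
      ∑ i ∈ Finset.Icc 1 (typeLength R K), len (dual (trunc J i)) (dual (trunc J (i - 1))) := by
    refine (Finset.sum_le_sum fun i hi => ?_).trans (Finset.sum_le_sum_of_subset (Gam_subset J))
    obtain ⟨hi, hiJ⟩ := Finset.mem_filter.1 hi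
    obtain ⟨j, rfl⟩ := Nat.exists_eq_add_of_le' (Finset.mem_Icc.1 hi).1
    exact typeSeq_succ_le hres hJ hJR (Finset.mem_Icc.1 hi).2 hiJ
  rw [dInv, sub_nonneg]
  change _ ≤ colen R K (dual J)
  rw [← sum_len_dual_trunc hres hJ hJR]
  exact_mod_cast hle

end TypeSequence

section Powers

variable {R : Type*} [CommRing R] {K : Type*} [Field K] [Algebra R K] {I : Ideal R} {x : R}

theorem powK_add (I : Ideal R) (m n : ℕ) : powK K I (m + n) = powK K I m * powK K I n := by
  rw [← IsLocalization.coeSubmodule_mul, ← pow_add]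

theorem coeSubmodule_span_singleton_mul (x : R) (J : Ideal R) :
    IsLocalization.coeSubmodule K (Ideal.span {x} * J) =
      algebraMap R K x • IsLocalization.coeSubmodule K J := by
  rw [IsLocalization.coeSubmodule_mul, IsLocalization.coeSubmodule_span_singleton,
    Submodule.span_singleton_mul]

theorem smul_powK_le (hx : x ∈ I) (n : ℕ) : algebraMap R K x • powK K I n ≤ powK K I (n + 1) := by
  rw [← coeSubmodule_span_singleton_mul, powK, pow_succ']
  exact Submodule.map_mono (Ideal.mul_mono_left ((Ideal.span_singleton_le_iff_mem _).2 hx))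

theorem powK_le_base (I : Ideal R) (n : ℕ) : powK K I n ≤ base R K := by
  rintro _ ⟨r, -, rfl⟩
  exact Submodule.mem_one.2 ⟨r, rfl⟩

theorem powK_zero (I : Ideal R) : powK K I 0 = base R K := by
  rw [powK, pow_zero, Ideal.one_eq_top, IsLocalization.coeSubmodule_top]

theorem powK_succ_le (I : Ideal R) (n : ℕ) : powK K I (n + 1) ≤ powK K I n :=
  Submodule.map_mono (Ideal.pow_le_pow_right n.le_succ)

theorem pow_mem_powK (hx : x ∈ I) (n : ℕ) : algebraMap R K x ^ n ∈ powK K I n :=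
  ⟨x ^ n, Ideal.pow_mem_pow hx n, map_pow (algebraMap R K) x n⟩

theorem base_le_Lam (I : Ideal R) : base R K ≤ Lam K I :=
  Submodule.one_le.2 ((mem_Lam K I 1).2
    ⟨0, Submodule.mem_div_iff_forall_mul_mem.2 fun y hy => by rwa [one_mul]⟩)

theorem mul_mem_Lam {y z : K} (hy : y ∈ Lam K I) (hz : z ∈ Lam K I) : y * z ∈ Lam K I := by
  obtain ⟨m, hm⟩ := (mem_Lam K I y).1 hy
  obtain ⟨n, hn⟩ := (mem_Lam K I z).1 hz
  have hm' := powK_div_powK_mono K I (le_max_left m n) hm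
  have hn' := powK_div_powK_mono K I (le_max_right m n) hn
  refine (mem_Lam K I _).2 ⟨max m n, Submodule.mem_div_iff_forall_mul_mem.2 fun b hb => ?_⟩
  rw [mul_assoc]
  exact Submodule.mem_div_iff_forall_mul_mem.1 hm' _
    (Submodule.mem_div_iff_forall_mul_mem.1 hn' b hb)

variable [IsFractionRing R K]

theorem hilbertFunction_eq_len (I : Ideal R) (n : ℕ) :
    hilbertFunction I n = len (powK K I n) (powK K I (n + 1)) := by
  rw [hilbertFunction, len, powK, powK, IsLocalization.coeSubmodule, IsLocalization.coeSubmodule,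
    length_subquotient_map]
  exact IsFractionRing.injective R K

variable [IsDomain R]

theorem powK_ne_bot (hI : I ≠ ⊥) (n : ℕ) : powK K I n ≠ ⊥ :=
  ((IsFractionRing.coeSubmodule_injective R K).ne_iff' (IsLocalization.coeSubmodule_bot K)).2
    (pow_ne_zero n hI)

variable [IsDiscreteValuationRing (integralClosure R K)]

theorem Lam_le_intCl (hI : I ≠ ⊥) : Lam K I ≤ intCl R K :=
  iSup_le fun n => div_self_le_intCl ((powK_le_base I n).trans base_le_intCl) (powK_ne_bot hI n)

theorem powK_le_valGE {m : ℕ} (h : powK K I 1 ≤ valGE R K m) (n : ℕ) :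
    powK K I n ≤ valGE R K (n * m : ℕ) := by
  induction n with
  | zero =>
    rw [zero_mul, Nat.cast_zero, valGE_zero, powK_zero]
    exact base_le_intCl
  | succ n ih =>
    rw [powK_add, Nat.succ_mul, Nat.cast_add]
    exact (mul_le_mul' ih h).trans (valGE_mul_le _ _)

variable [Module.Finite R (integralClosure R K)]

theorem hilbertFunction_eq_colen_sub (hres : ResiduallyRational R K) (hI : I ≠ ⊥) (n : ℕ) :
    (hilbertFunction I n : ℤ) = colen R K (powK K I (n + 1)) - colen R K (powK K I n) := by
  rw [hilbertFunction_eq_len (K := K), len_eq_colen_sub hres (powK_ne_bot hI _) (powK_succ_le I n)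
    ((powK_le_base I n).trans base_le_intCl)]

theorem colen_smul_powK (hres : ResiduallyRational R K) (hI : I ≠ ⊥) {m : ℕ}
    (hxm : val R K (algebraMap R K x) = WithZero.exp (-(m : ℤ))) (n : ℕ) :
    colen R K (algebraMap R K x • powK K I n) = colen R K (powK K I n) + m :=
  colen_smul hres hxm ((powK_le_base I n).trans base_le_intCl) (powK_ne_bot hI n)

theorem exists_isMinimalReduction (hres : ResiduallyRational R K) (hI : I ≠ ⊥) :
    ∃ x, IsMinimalReduction I x := by
  obtain ⟨_, ⟨x, hx, rfl⟩, m, hxm, hIm⟩ := exists_val_eq_exp_and_le_valGE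
    ((powK_le_base (K := K) I 1).trans base_le_intCl) (powK_ne_bot hI 1)
  rw [SetLike.mem_coe, pow_one] at hx
  have hle : ∀ n, powK K I n ≤ intCl R K := fun n => (powK_le_base I n).trans base_le_intCl
  have hsmul := smul_powK_le (K := K) hx
  have hsmul0 : ∀ n, algebraMap R K x • powK K I n ≠ ⊥ := fun n =>
    smul_ne_bot (ne_zero_of_val_eq_exp hxm) (powK_ne_bot hI n)
  have hdefect : ∀ n, (len (valGE R K (n * m : ℕ)) (powK K I n) : ℤ) =
      colen R K (powK K I n) - n * m := fun n => by
    rw [len_eq_colen_sub hres (powK_ne_bot hI n) (powK_le_valGE hIm n)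
      (valGE_natCast_le_intCl _), colen_valGE hres, Nat.cast_mul]
  have hanti : Antitone fun n => len (valGE R K (n * m : ℕ)) (powK K I n) :=
    antitone_nat_of_succ_le fun n => by
      have h := colen_anti hres (hsmul0 n) (hsmul n) (hle _)
      rw [colen_smul_powK hres hI hxm] at h
      rw [← Nat.cast_le (α := ℤ), hdefect, hdefect]
      push_cast
      linarith
  obtain ⟨N, hN⟩ := WellFoundedLT.antitone_chain_condition hanti
  refine ⟨x, hx, N, fun n hn => IsFractionRing.coeSubmodule_injective R K ?_⟩
  have hstep : (len (valGE R K (n * m : ℕ)) (powK K I n) : ℤ) =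
      len (valGE R K ((n + 1) * m : ℕ)) (powK K I (n + 1)) := by
    exact_mod_cast (hN n hn).symm.trans (hN (n + 1) (hn.trans n.le_succ))
  rw [hdefect, hdefect] at hstep
  push_cast at hstep
  rw [coeSubmodule_span_singleton_mul]
  refine eq_of_colen_eq hres (hsmul0 n) (hsmul n) (hle _) ?_
  rw [colen_smul_powK hres hI hxm]
  linarith

end Powers

section MinimalReduction

variable {R : Type*} [CommRing R] {I : Ideal R} {x : R} {n : ℕ}

theorem IsMinimalReduction.pow_succ_eq (h : IsMinimalReduction I x)
    (hn : reductionExponent I x ≤ n) : I ^ (n + 1) = Ideal.span {x} * I ^ n :=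
  Nat.sInf_mem (s := {m : ℕ | ∀ n ≥ m, I ^ (n + 1) = Ideal.span {x} * I ^ n}) h.2 n hn

theorem IsMinimalReduction.ne_zero [IsDomain R] (h : IsMinimalReduction I x) (hI : I ≠ ⊥) :
    x ≠ 0 := by
  rintro rfl
  have hpow := h.pow_succ_eq le_rfl
  rw [Ideal.span_singleton_eq_bot.2 rfl, Ideal.bot_mul] at hpow
  exact pow_ne_zero _ hI hpow

variable {K : Type*} [Field K] [Algebra R K]

theorem IsMinimalReduction.powK_succ (h : IsMinimalReduction I x)
    (hn : reductionExponent I x ≤ n) :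
    powK K I (n + 1) = algebraMap R K x • powK K I n := by
  rw [powK, h.pow_succ_eq hn, coeSubmodule_span_singleton_mul]

theorem IsMinimalReduction.powK_reductionExponent_add (h : IsMinimalReduction I x) (n : ℕ) :
    powK K I (reductionExponent I x + n) =
      algebraMap R K x ^ n • powK K I (reductionExponent I x) := by
  induction n with
  | zero => rw [pow_zero, one_smul, add_zero]
  | succ n ih => rw [← add_assoc, h.powK_succ (Nat.le_add_right _ n), ih, pow_succ', mul_smul]

variable [IsDomain R] [IsFractionRing R K]

theorem IsMinimalReduction.algebraMap_pow_ne_zero (h : IsMinimalReduction I x) (hI : I ≠ ⊥)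
    (n : ℕ) : algebraMap R K x ^ n ≠ 0 :=
  pow_ne_zero n ((map_ne_zero_iff _ (IsFractionRing.injective R K)).2 (h.ne_zero hI))

theorem IsMinimalReduction.powK_le_smul_Lam (h : IsMinimalReduction I x) (hI : I ≠ ⊥) :
    powK K I (reductionExponent I x) ≤
      algebraMap R K x ^ reductionExponent I x • Lam K I := by
  have hx := h.algebraMap_pow_ne_zero (K := K) hI (reductionExponent I x)
  intro a ha
  rw [Submodule.mem_smul_iff_inv_mul_mem hx, mem_Lam]
  refine ⟨reductionExponent I x, Submodule.mem_div_iff_forall_mul_mem.2 fun b hb => ?_⟩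
  rw [mul_assoc, ← Submodule.mem_smul_iff_inv_mul_mem hx, ← h.powK_reductionExponent_add, powK_add]
  exact Submodule.mul_mem_mul ha hb

theorem IsMinimalReduction.smul_Lam_le_powK (h : IsMinimalReduction I x) (hI : I ≠ ⊥) :
    algebraMap R K x ^ reductionExponent I x • Lam K I ≤ powK K I (reductionExponent I x) := by
  rintro _ ⟨y, hy, rfl⟩
  obtain ⟨n, hn⟩ := (mem_Lam K I y).1 hy
  have hyn := powK_div_powK_mono K I (Nat.le_add_left n (reductionExponent I x)) hn
  have hmem := Submodule.mem_div_iff_forall_mul_mem.1 hyn _ (pow_mem_powK h.1 _)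
  rwa [h.powK_reductionExponent_add, pow_add, ← mul_assoc, mul_comm,
    Submodule.mem_smul_iff_inv_mul_mem (h.algebraMap_pow_ne_zero hI n),
    inv_mul_cancel_left₀ (h.algebraMap_pow_ne_zero hI n), mul_comm] at hmem

theorem IsMinimalReduction.powK_eq_smul_Lam (h : IsMinimalReduction I x) (hI : I ≠ ⊥) :
    powK K I (reductionExponent I x) =
      algebraMap R K x ^ reductionExponent I x • Lam K I :=
  (h.powK_le_smul_Lam hI).antisymm (h.smul_Lam_le_powK hI)

theorem IsMinimalReduction.powK_le_dual_Lam (h : IsMinimalReduction I x) (hI : I ≠ ⊥) :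
    powK K I (reductionExponent I x) ≤ dual (Lam K I) := by
  intro b hb
  refine mem_dual.2 fun y hy => powK_le_base I (reductionExponent I x) ?_
  rw [h.powK_eq_smul_Lam hI] at hb ⊢
  obtain ⟨c, hc, rfl⟩ := hb
  exact ⟨c * y, mul_mem_Lam hc hy, (mul_assoc _ _ _).symm⟩

theorem IsMinimalReduction.dual_dual_Lam (h : IsMinimalReduction I x) (hI : I ≠ ⊥)
    (hd : dual (Lam K I) = powK K I (reductionExponent I x)) :
    dual (dual (Lam K I)) = Lam K I := by
  have hx := h.algebraMap_pow_ne_zero (K := K) hI (reductionExponent I x)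
  rw [hd, h.powK_eq_smul_Lam hI, dual_smul hx, hd, h.powK_eq_smul_Lam hI, inv_smul_smul₀ hx]

variable [IsDiscreteValuationRing (integralClosure R K)] [Module.Finite R (integralClosure R K)]

theorem IsMinimalReduction.hilbertFunction_eq (hres : ResiduallyRational R K)
    (h : IsMinimalReduction I x) (hI : I ≠ ⊥) {m : ℕ}
    (hxm : val R K (algebraMap R K x) = WithZero.exp (-(m : ℤ)))
    (hn : reductionExponent I x ≤ n) : (hilbertFunction I n : ℤ) = m := by
  rw [hilbertFunction_eq_colen_sub hres hI, h.powK_succ hn, colen_smul_powK hres hI hxm,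
    add_sub_cancel_left]

theorem IsMinimalReduction.exists_val_eq_idealMult (hres : ResiduallyRational R K)
    (h : IsMinimalReduction I x) (hI : I ≠ ⊥) :
    ∃ m : ℕ, val R K (algebraMap R K x) = WithZero.exp (-(m : ℤ)) ∧ idealMult I = m := by
  have hx0 := h.algebraMap_pow_ne_zero (K := K) hI 1
  rw [pow_one] at hx0
  obtain ⟨m, hm⟩ := exists_val_eq_exp_natCast ((integralClosure R K).algebraMap_mem x) hx0
  exact ⟨m, hm, idealMult_eq fun _ hn => h.hilbertFunction_eq hres hI hm hn⟩

theorem IsMinimalReduction.colen_powK (hres : ResiduallyRational R K)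
    (h : IsMinimalReduction I x) (hI : I ≠ ⊥) :
    colen R K (powK K I (reductionExponent I x)) =
      colen R K (Lam K I) + idealMult I * reductionExponent I x := by
  obtain ⟨m, hm, hmult⟩ := h.exists_val_eq_idealMult hres hI
  have hpow : val R K (algebraMap R K x ^ reductionExponent I x) =
      WithZero.exp (-((reductionExponent I x * m : ℕ) : ℤ)) := by
    rw [map_pow, hm, ← WithZero.exp_nsmul, smul_neg, nsmul_eq_mul, Nat.cast_mul]
  rw [h.powK_eq_smul_Lam hI, colen_smul hres hpow (Lam_le_intCl hI)
    (ne_bot_of_le_ne_bot base_ne_bot (base_le_Lam I)), hmult, Nat.cast_mul, mul_comm (m : ℤ)]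

theorem IsMinimalReduction.genus_eq (hres : ResiduallyRational R K)
    (h : IsMinimalReduction I x) (hI : I ≠ ⊥) :
    genus I = colen R K (base R K) - colen R K (Lam K I) := by
  obtain ⟨m, hm, hmult⟩ := h.exists_val_eq_idealMult hres hI
  have hsum : ∑ n ∈ Finset.range (reductionExponent I x), (hilbertFunction I n : ℤ) =
      colen R K (powK K I (reductionExponent I x)) - colen R K (base R K) := by
    rw [← powK_zero I, ← Finset.sum_range_sub fun n => colen R K (powK K I n)]
    exact Finset.sum_congr rfl fun n _ => hilbertFunction_eq_colen_sub hres hI n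
  rw [BlowUp.genus_eq fun n hn => h.hilbertFunction_eq hres hI hm hn, hsum, h.colen_powK hres hI,
    hmult]
  ring

theorem IsMinimalReduction.two_mul_genus (hres : ResiduallyRational R K)
    (h : IsMinimalReduction I x) (hI : I ≠ ⊥) :
    2 * genus I = idealMult I * (reductionExponent I x : ℤ)
      + ∑ i ∈ Finset.Icc 1 (typeLength R K) \ Gam (dual (Lam K I)), ((typeSeq R K i : ℤ) - 1)
      - dInv (dual (Lam K I))
      - (len (dual (dual (Lam K I))) (Lam K I) : ℤ)
      - (len (dual (Lam K I)) (powK K I (reductionExponent I x)) : ℤ) := by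
  have hJ : conductor R K ≤ dual (Lam K I) := dual_anti (Lam_le_intCl hI)
  have hJR : dual (Lam K I) ≤ base R K := dual_le_base (base_le_Lam I)
  have hd : dInv (dual (Lam K I)) = colen R K (dual (dual (Lam K I))) -
    ∑ i ∈ Gam (dual (Lam K I)), (typeSeq R K i : ℤ) := rfl
  have htype := Finset.sum_sdiff (f := fun i => (typeSeq R K i : ℤ)) (Gam_subset (dual (Lam K I)))
  rw [sum_typeSeq hres] at htype
  rw [len_eq_colen_sub hres (ne_bot_of_le_ne_bot base_ne_bot (base_le_Lam I)) (le_dual_dual _)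
      (dual_le_intCl hJ),
    len_eq_colen_sub hres (powK_ne_bot hI _) (h.powK_le_dual_Lam hI) (hJR.trans base_le_intCl),
    hd, h.genus_eq hres hI, h.colen_powK hres hI, Finset.sum_sub_distrib, Finset.sum_const,
    nsmul_one, card_sdiff_Gam hres hJ hJR, ← htype]
  ring

theorem IsMinimalReduction.two_mul_genus_eq_iff (hres : ResiduallyRational R K)
    (h : IsMinimalReduction I x) (hI : I ≠ ⊥) :
    2 * genus I = idealMult I * (reductionExponent I x : ℤ)
      + ∑ i ∈ Finset.Icc 1 (typeLength R K) \ Gam (dual (Lam K I)), ((typeSeq R K i : ℤ) - 1) ↔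
    dual (Lam K I) = powK K I (reductionExponent I x) ∧ dInv (dual (Lam K I)) = 0 := by
  have hJR : dual (Lam K I) ≤ base R K := dual_le_base (base_le_Lam I)
  have hle : dual (Lam K I) ≤ intCl R K := hJR.trans base_le_intCl
  have hd := dInv_nonneg hres (dual_anti (Lam_le_intCl hI)) hJR
  have hgenus := h.two_mul_genus hres hI
  constructor
  · intro heq
    have hlen : len (dual (Lam K I)) (powK K I (reductionExponent I x)) = 0 := by lia
    rw [len_eq_zero_iff hres hle (powK_ne_bot hI _)] at hlen
    exact ⟨hlen.antisymm (h.powK_le_dual_Lam hI), by lia⟩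
  · rintro ⟨hJ, hd0⟩
    have hLam := (len_eq_zero_iff hres (Lam_le_intCl hI)
      (ne_bot_of_le_ne_bot base_ne_bot (base_le_Lam I))).2 (le_refl (Lam K I))
    have hpow := (len_eq_zero_iff hres hle (powK_ne_bot hI (reductionExponent I x))).2 hJ.le
    rw [hgenus, hd0, hpow, h.dual_dual_Lam hI hJ, hLam, Nat.cast_zero, sub_zero, sub_zero, sub_zero]

end MinimalReduction

end BlowUp

end

open BlowUp in
theorem theorem4p6_general {R : Type*} [CommRing R] [IsDomain R]
    (K : Type*) [Field K] [Algebra R K] [IsFractionRing R K]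
    [Module.Finite R (integralClosure R K)] [IsDiscreteValuationRing (integralClosure R K)]
    (hres : ResiduallyRational R K) (I : Ideal R) (hI : I ≠ ⊥) :
    (∃ x, IsMinimalReduction I x) ∧
    ∀ x, IsMinimalReduction I x →
      2 * genus I = idealMult I * (reductionExponent I x : ℤ)
          + ∑ i ∈ Finset.Icc 1 (typeLength R K) \ Gam (dual (Lam K I)), ((typeSeq R K i : ℤ) - 1)
          - dInv (dual (Lam K I))
          - (len (dual (dual (Lam K I))) (Lam K I) : ℤ)
          - (len (dual (Lam K I)) (powK K I (reductionExponent I x)) : ℤ) ∧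
      (2 * genus I = idealMult I * (reductionExponent I x : ℤ)
          + ∑ i ∈ Finset.Icc 1 (typeLength R K) \ Gam (dual (Lam K I)), ((typeSeq R K i : ℤ) - 1) ↔
        dual (Lam K I) = powK K I (reductionExponent I x) ∧ dInv (dual (Lam K I)) = 0) :=
  ⟨exists_isMinimalReduction hres hI, fun _ h =>
    ⟨h.two_mul_genus hres hI, h.two_mul_genus_eq_iff hres hI⟩⟩

open BlowUp in
theorem theorem4p6 {R : Type*} [CommRing R] [IsDomain R] [IsLocalRing R] [IsNoetherianRing R]
    (hdim : ringKrullDim R = 1) [Infinite (IsLocalRing.ResidueField R)]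
    (K : Type*) [Field K] [Algebra R K] [IsFractionRing R K]
    [Module.Finite R (integralClosure R K)] [IsDiscreteValuationRing (integralClosure R K)]
    (hres : ResiduallyRational R K)
    (I : Ideal R) (hI : I.IsPrimary ∧ I.radical = IsLocalRing.maximalIdeal R)
    (hIp : ¬ Submodule.IsPrincipal I) :
    (∃ x, IsMinimalReduction I x) ∧
    ∀ x, IsMinimalReduction I x →
      -- (1): `Λ = Lam K I`, `R : Λ = dual (Lam K I)`, `Λ** = dual (dual (Lam K I))`
      2 * genus I = idealMult I * (reductionExponent I x : ℤ)
          + ∑ i ∈ Finset.Icc 1 (typeLength R K) \ Gam (dual (Lam K I)), ((typeSeq R K i : ℤ) - 1)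
          - dInv (dual (Lam K I))
          - (len (dual (dual (Lam K I))) (Lam K I) : ℤ)
          - (len (dual (Lam K I)) (powK K I (reductionExponent I x)) : ℤ) ∧
      -- (2)
      (2 * genus I = idealMult I * (reductionExponent I x : ℤ)
          + ∑ i ∈ Finset.Icc 1 (typeLength R K) \ Gam (dual (Lam K I)), ((typeSeq R K i : ℤ) - 1) ↔
        dual (Lam K I) = powK K I (reductionExponent I x) ∧ dInv (dual (Lam K I)) = 0) :=
  theorem4p6_general K hres I (by rintro rfl; exact hIp inferInstance)
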